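/- Let $0<p<\infty$ and let $D$ be the open unit disc in $\mathbb{C}$. Then there exists a holomorphic function $f$ on $D$ such that 1) $\displaystyle\sup_{0<r<1}\int_0^{2\pi}|f(re^{i\theta})|^q\,d\theta<\infty$ for all $0<q<p$, and 2) $\displaystyle\sup_{0<r<1}\int_a^b|f(re^{i\theta})|^\delta\,d\theta=\infty$ for all $p\le\delta<\infty$ and all real $a<b$. Moreover, the set of all such functions $f$ is a dense $G_\delta$ subset of $\bigcap_{0<q<p}H^q$. Here $H^q$ is the Hardy space of all holomorphic functions $f$ on $D$ with $S_q(f)=\sup_{0<r<1}\int_0^{2\pi}|f(re^{i\theta})|^q\,d\theta<\infty$, with the metric $d_q(f,g)=S_q(f-g)^{\min(1,1/q)}$, and the intersection carries its natural topology, the coarsest one for which all the inclusions into $H^q$, $0<q<p$, are continuous. -/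

import Mathlib

open MeasureTheory Set
open scoped ENNReal

noncomputable section

/-- `sup_{0 < r < 1} ∫_a^b |f (r e^{iθ})|^q dθ`, as an element of `[0, ∞]`. -/
def hardySup (q a b : ℝ) (f : ℂ → ℂ) : ℝ≥0∞ :=
  ⨆ r ∈ Ioo (0 : ℝ) 1, ∫⁻ θ in Ioc a b, ‖f (circleMap 0 r θ)‖ₑ ^ q

/-- The Hardy space `H^q` of the open unit disc. A holomorphic function on the disc is recorded
as a function on `ℂ` vanishing off the disc, so that each one has exactly one representative. -/
@[ext]
structure HardySpace (q : ℝ) where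
  toFun : ℂ → ℂ
  holo : DifferentiableOn ℂ toFun (Metric.ball 0 1)
  zero_off : ∀ z, z ∉ Metric.ball (0 : ℂ) 1 → toFun z = 0
  sup_lt_top : hardySup q 0 (2 * Real.pi) toFun < ⊤

/-- The intersection of the Hardy spaces `H^q` over `0 < q < p`. -/
@[ext]
structure HardyInter (p : ℝ) where
  toFun : ℂ → ℂ
  holo : DifferentiableOn ℂ toFun (Metric.ball 0 1)
  zero_off : ∀ z, z ∉ Metric.ball (0 : ℂ) 1 → toFun z = 0
  sup_lt_top : ∀ q, 0 < q → q < p → hardySup q 0 (2 * Real.pi) toFun < ⊤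

/-- The inclusion of the intersection into one of the spaces intersected. -/
def HardyInter.incl {p : ℝ} (q : ℝ) (h0 : 0 < q) (hp : q < p) (f : HardyInter p) :
    HardySpace q :=
  ⟨f.toFun, f.holo, f.zero_off, f.sup_lt_top q h0 hp⟩

theorem measurable_circle_of_holo {f : ℂ → ℂ} (hf : DifferentiableOn ℂ f (Metric.ball 0 1))
    {r : ℝ} (hr : r ∈ Ioo (0 : ℝ) 1) :
    Measurable (fun θ : ℝ => ‖f (circleMap 0 r θ)‖ₑ) := by
  have h : Continuous (fun θ : ℝ => f (circleMap 0 r θ)) :=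
    hf.continuousOn.comp_continuous (continuous_circleMap 0 r) (fun θ => by
      simp [abs_of_pos hr.1, hr.2])
  exact h.measurable.enorm

/-- The distance of the Hardy space `H^q`: `‖f - g‖_q` (as an `L^q` norm) for `q ≥ 1`, and
`‖f - g‖_q ^ q` for `q ≤ 1`. -/
def hardyDist (q : ℝ) (f g : ℂ → ℂ) : ℝ≥0∞ :=
  hardySup q 0 (2 * Real.pi) (f - g) ^ min 1 (1 / q)

theorem hardyDist_comm (q : ℝ) (f g : ℂ → ℂ) : hardyDist q f g = hardyDist q g f := by
  simp only [hardyDist, hardySup, Pi.sub_apply, enorm_sub_rev]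

theorem hardyDist_triangle {q : ℝ} (hq : 0 < q) {f g h : ℂ → ℂ}
    (hf : DifferentiableOn ℂ f (Metric.ball 0 1)) (hg : DifferentiableOn ℂ g (Metric.ball 0 1))
    (hh : DifferentiableOn ℂ h (Metric.ball 0 1)) :
    hardyDist q f h ≤ hardyDist q f g + hardyDist q g h := by
  have he : (0 : ℝ) < min 1 (1 / q) := lt_min one_pos (by positivity)
  have hsub : ∀ r θ, ‖(f - h) (circleMap 0 r θ)‖ₑ ^ q
      ≤ (‖(f - g) (circleMap 0 r θ)‖ₑ + ‖(g - h) (circleMap 0 r θ)‖ₑ) ^ q := by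
    intro r θ
    refine ENNReal.rpow_le_rpow ?_ hq.le
    have : (f - h) (circleMap 0 r θ) = (f - g) (circleMap 0 r θ) + (g - h) (circleMap 0 r θ) := by
      simp
    rw [this]
    exact enorm_add_le _ _
  have hle : ∀ (u : ℂ → ℂ), ∀ r ∈ Ioo (0 : ℝ) 1,
      ∫⁻ θ in Ioc 0 (2 * Real.pi), ‖u (circleMap 0 r θ)‖ₑ ^ q ≤ hardySup q 0 (2 * Real.pi) u :=
    fun u r hr => le_iSup₂ (f := fun r (_ : r ∈ Ioo (0 : ℝ) 1) =>
      ∫⁻ θ in Ioc 0 (2 * Real.pi), ‖u (circleMap 0 r θ)‖ₑ ^ q) r hr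
  unfold hardyDist
  rw [← ENNReal.le_rpow_inv_iff he]
  refine iSup₂_le fun r hr => ?_
  rw [ENNReal.le_rpow_inv_iff he]
  have m1 := measurable_circle_of_holo (hf.sub hg) hr
  have m2 := measurable_circle_of_holo (hg.sub hh) hr
  refine le_trans ?_ (add_le_add (ENNReal.rpow_le_rpow (hle (f - g) r hr) he.le)
    (ENNReal.rpow_le_rpow (hle (g - h) r hr) he.le))
  refine (ENNReal.rpow_le_rpow (lintegral_mono (hsub r)) he.le).trans ?_
  rcases le_total q 1 with h1 | h1
  · rw [min_eq_left (by rw [le_div_iff₀ hq]; linarith)]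
    simp only [ENNReal.rpow_one]
    rw [← lintegral_add_left (m1.pow_const q)]
    exact lintegral_mono fun θ => ENNReal.rpow_add_le_add_rpow _ _ hq.le h1
  · rw [min_eq_right (by rw [div_le_iff₀ hq]; linarith)]
    exact ENNReal.lintegral_Lp_add_le m1.aemeasurable m2.aemeasurable h1

/-- The metric structure of the Hardy space `H^q`, `0 < q < ∞`. -/
@[reducible] def hardyMetric (q : ℝ) (hq : 0 < q) : PseudoEMetricSpace (HardySpace q) where
  edist f g := hardyDist q f.toFun g.toFun
  edist_self f := by
    simp [hardyDist, hardySup, hq]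
  edist_comm f g := hardyDist_comm q f.toFun g.toFun
  edist_triangle f g h := hardyDist_triangle hq f.holo g.holo h.holo

/-- The natural topology of the intersection: the coarsest one that makes all the inclusions
into `H^q`, `0 < q < p`, continuous. -/
instance HardyInter.topology (p : ℝ) : TopologicalSpace (HardyInter p) :=
  ⨅ (q : ℝ) (h0 : 0 < q) (hp : q < p),
    TopologicalSpace.induced (HardyInter.incl q h0 hp)
      (hardyMetric q h0).toUniformSpace.toTopologicalSpace

end

/-! The `G_δ` part is semicontinuity. On a bounded interval a finite supremum for an exponent `δ ≥
p` forces one for `p`, so `δ = p` and countably many rational intervals suffice. For a fixed radius,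
Fatou's lemma makes `∫_a^b |f(re^{iθ})|^p ≤ c` a closed condition already in `H^{p/2}`
(`isClosed_setOf_setLIntegral_circleMap_le`).

Density follows from a single `F` in the intersection that is bad for `p` on every interval, without
Baire's theorem: for any `g`, each rational interval excludes at most one real `c` for `g + cF`, so
good `c` tend to `0`.

To build `F` when `p ≥ 2`, put `∑ 2^{-j-1} (1 - e^{-it_j} z)^{-1/p}` with `t_j` dense. As `1/p ≤
1/2`, the values of all terms lie in a sector about the positive axis, so nothing cancels and the
sum dominates each term; the `p`-th power of a term has the non-integrable size `1/|θ - t_j|` at the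
boundary. For `q < p` the terms are uniformly bounded in `H^q`. For smaller `p`, take the `m`-th
power of the function built for `mp ≥ 2`. -/

open Filter Topology

/-! ### Elementary properties of the circle integrals -/

/-- The integral of a periodic function over one period does not depend on the period chosen. -/
theorem Function.Periodic.setLIntegral_Ioc_eq {φ : ℝ → ℝ≥0∞} {T : ℝ} (h : Function.Periodic φ T)
    (hT : 0 < T) (a b : ℝ) :
    ∫⁻ θ in Ioc a (a + T), φ θ = ∫⁻ θ in Ioc b (b + T), φ θ := by
  have : VAddInvariantMeasure (AddSubgroup.zmultiples T) ℝ volume :=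
    ⟨fun c s _ => measure_preimage_add _ _ _⟩
  refine (isAddFundamentalDomain_Ioc hT a).setLIntegral_eq (isAddFundamentalDomain_Ioc hT b) φ ?_
  rintro ⟨g, hg⟩ x
  obtain ⟨n, rfl⟩ := AddSubgroup.mem_zmultiples_iff.1 hg
  have := h.zsmul n x
  simpa [AddSubgroup.vadd_def, add_comm] using this

theorem setLIntegral_circleMap_le_hardySup {q a b r : ℝ} (hr : r ∈ Ioo (0 : ℝ) 1) (f : ℂ → ℂ) :
    ∫⁻ θ in Ioc a b, ‖f (circleMap 0 r θ)‖ₑ ^ q ≤ hardySup q a b f :=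
  le_iSup₂ (f := fun r (_ : r ∈ Ioo (0 : ℝ) 1) =>
    ∫⁻ θ in Ioc a b, ‖f (circleMap 0 r θ)‖ₑ ^ q) r hr

theorem hardySup_mono_interval {q a b a' b' : ℝ} (ha : a' ≤ a) (hb : b ≤ b') (f : ℂ → ℂ) :
    hardySup q a b f ≤ hardySup q a' b' f :=
  iSup₂_mono fun _ _ => lintegral_mono_set (Ioc_subset_Ioc ha hb)

theorem hardySup_const_smul {q : ℝ} (hq : 0 ≤ q) (a b : ℝ) (c : ℂ) (f : ℂ → ℂ) :
    hardySup q a b (c • f) = ‖c‖ₑ ^ q * hardySup q a b f := by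
  simp only [hardySup, ENNReal.mul_iSup, Pi.smul_apply, enorm_smul, ENNReal.mul_rpow_of_nonneg _ _ hq]
  refine iSup_congr fun r => iSup_congr fun _ => lintegral_const_mul' _ _ ?_
  exact ENNReal.rpow_ne_top_of_nonneg hq enorm_ne_top

theorem hardySup_add_lt_top {q : ℝ} (hq : 0 < q) {a b : ℝ} {f g : ℂ → ℂ}
    (hf : DifferentiableOn ℂ f (Metric.ball 0 1))
    (hfs : hardySup q a b f < ⊤) (hgs : hardySup q a b g < ⊤) :
    hardySup q a b (f + g) < ⊤ := by
  have key : ∀ x y : ℝ≥0∞, (x + y) ^ q ≤ 2 ^ q * (x ^ q + y ^ q) := by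
    intro x y
    have : x + y ≤ 2 * max x y := by
      rw [two_mul]; exact add_le_add (le_max_left _ _) (le_max_right _ _)
    refine (ENNReal.rpow_le_rpow this hq.le).trans ?_
    rw [ENNReal.mul_rpow_of_nonneg _ _ hq.le]
    gcongr
    rcases le_total x y with h | h
    · rw [max_eq_right h]; exact le_add_self
    · rw [max_eq_left h]; exact le_self_add
  have h2 : (2 : ℝ≥0∞) ^ q ≠ ⊤ := ENNReal.rpow_ne_top_of_nonneg hq.le (by simp)
  refine lt_of_le_of_lt (b := 2 ^ q * (hardySup q a b f + hardySup q a b g)) ?_ ?_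
  · refine iSup₂_le fun r hr => ?_
    calc ∫⁻ θ in Ioc a b, ‖(f + g) (circleMap 0 r θ)‖ₑ ^ q
        ≤ ∫⁻ θ in Ioc a b, 2 ^ q * (‖f (circleMap 0 r θ)‖ₑ ^ q + ‖g (circleMap 0 r θ)‖ₑ ^ q) :=
          lintegral_mono fun θ =>
            (ENNReal.rpow_le_rpow (enorm_add_le _ _) hq.le).trans (key _ _)
      _ = 2 ^ q * ((∫⁻ θ in Ioc a b, ‖f (circleMap 0 r θ)‖ₑ ^ q) +
            ∫⁻ θ in Ioc a b, ‖g (circleMap 0 r θ)‖ₑ ^ q) := by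
          rw [lintegral_const_mul' _ _ h2,
            lintegral_add_left ((measurable_circle_of_holo hf hr).pow_const q)]
      _ ≤ _ := by
          gcongr <;> exact setLIntegral_circleMap_le_hardySup hr _
  · exact ENNReal.mul_lt_top h2.lt_top (ENNReal.add_lt_top.2 ⟨hfs, hgs⟩)

/-- On a bounded interval, finiteness for one exponent gives finiteness for all smaller ones. -/
theorem hardySup_lt_top_of_exponent_le {q s a b : ℝ} (hq : 0 < q) (hqs : q ≤ s) {f : ℂ → ℂ}
    (h : hardySup s a b f < ⊤) : hardySup q a b f < ⊤ := by
  have key : ∀ x : ℝ≥0∞, x ^ q ≤ 1 + x ^ s := by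
    intro x
    rcases le_total x 1 with h | h
    · exact (ENNReal.rpow_le_one h hq.le).trans le_self_add
    · exact (ENNReal.rpow_le_rpow_of_exponent_le h hqs).trans le_add_self
  refine lt_of_le_of_lt (b := ENNReal.ofReal (b - a) + hardySup s a b f) ?_
    (ENNReal.add_lt_top.2 ⟨ENNReal.ofReal_lt_top, h⟩)
  refine iSup₂_le fun r hr => ?_
  refine (lintegral_mono fun θ => key _).trans ?_
  rw [lintegral_add_left measurable_const]
  refine add_le_add ?_ (setLIntegral_circleMap_le_hardySup hr _)
  simp

/-! ### The `G_δ` property -/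

/-- The bound `2π` on the length lets each interval fit in one period, where the `H^q` distance
controls the integral. -/
theorem setOf_hardySup_eq_top_eq_iInter {p : ℝ} (hp : 0 < p) :
    {f : HardyInter p | ∀ δ : ℝ, p ≤ δ → ∀ a b : ℝ, a < b → hardySup δ a b f.toFun = ⊤} =
      ⋂ (ab : ℚ × ℚ) (_ : (ab.1 : ℝ) < ab.2 ∧ (ab.2 : ℝ) ≤ ab.1 + 2 * Real.pi),
        {f : HardyInter p | hardySup p ab.1 ab.2 f.toFun = ⊤} := by
  ext f
  simp only [mem_ofPred_eq, mem_iInter]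
  refine ⟨fun h ab hab => h p le_rfl _ _ hab.1, fun h δ hδ a b hab => ?_⟩
  obtain ⟨u, hau, hub⟩ := exists_rat_btwn hab
  obtain ⟨v, huv, hv⟩ := exists_rat_btwn (lt_min hub (lt_add_of_pos_right (u : ℝ) Real.two_pi_pos))
  have htop := h (u, v) ⟨huv, (hv.le.trans (min_le_right _ _))⟩
  by_contra hne
  have h1 := hardySup_lt_top_of_exponent_le hp hδ (lt_top_iff_ne_top.2 hne)
  have h2 := hardySup_mono_interval (q := p) hau.le (hv.le.trans (min_le_left _ _)) f.toFun
  exact (h2.trans_lt h1).ne htop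

/-- For a finite number `c`, only functions in a closed set of `H^q` satisfy
`∫_a^b |f (r e^{iθ})|^p dθ ≤ c`, whatever the exponent `p`. -/
theorem isClosed_setOf_setLIntegral_circleMap_le {q : ℝ} (hq : 0 < q) {p : ℝ} {a b r : ℝ}
    (hab : b ≤ a + 2 * Real.pi) (hr : r ∈ Ioo (0 : ℝ) 1) (c : ℝ≥0∞) :
    @IsClosed _ (hardyMetric q hq).toUniformSpace.toTopologicalSpace
      {f : HardySpace q | ∫⁻ θ in Ioc a b, ‖f.toFun (circleMap 0 r θ)‖ₑ ^ p ≤ c} := by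
  let _ := hardyMetric q hq
  refine IsSeqClosed.isClosed fun u f hu hlim => ?_
  have he : (0 : ℝ) < min 1 (1 / q) := lt_min one_pos (by positivity)
  have hd : Tendsto (fun n => hardyDist q (u n).toFun f.toFun) atTop (𝓝 0) :=
    tendsto_iff_edist_tendsto_0.1 hlim
  have hS : Tendsto (fun n => hardySup q 0 (2 * Real.pi) ((u n).toFun - f.toFun)) atTop (𝓝 0) := by
    have := (ENNReal.continuous_rpow_const (y := (min 1 (1 / q))⁻¹)).continuousAt.tendsto.comp hd
    simpa only [Function.comp_def, hardyDist, ENNReal.rpow_rpow_inv he.ne',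
      ENNReal.zero_rpow_of_pos (inv_pos.2 he)] using this
  have cont : ∀ g : HardySpace q, Continuous (fun θ : ℝ => g.toFun (circleMap 0 r θ)) := fun g =>
    g.holo.continuousOn.comp_continuous (continuous_circleMap 0 r) (fun θ => by
      simp [abs_of_pos hr.1, hr.2])
  have hI : Tendsto (fun n => ∫⁻ θ in Ioc a b,
      ‖(u n).toFun (circleMap 0 r θ) - f.toFun (circleMap 0 r θ)‖ₑ ^ q) atTop (𝓝 0) := by
    refine tendsto_of_tendsto_of_tendsto_of_le_of_le tendsto_const_nhds hS (fun _ => zero_le)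
      fun n => ?_
    have hper : Function.Periodic (fun θ : ℝ =>
        ‖((u n).toFun - f.toFun) (circleMap 0 r θ)‖ₑ ^ q) (2 * Real.pi) := fun θ => by
      simp only [periodic_circleMap 0 r θ]
    refine (lintegral_mono_set (Ioc_subset_Ioc_right hab)).trans ?_
    refine (hper.setLIntegral_Ioc_eq Real.two_pi_pos a 0).le.trans ?_
    rw [zero_add]
    exact setLIntegral_circleMap_le_hardySup hr _
  -- Convergence in `L^q` is used only to extract an a.e. convergent subsequence; Fatou then applies
  -- to any power `p`.
  have hm : TendstoInMeasure (volume.restrict (Ioc a b))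
      (fun n θ => (u n).toFun (circleMap 0 r θ)) atTop (fun θ => f.toFun (circleMap 0 r θ)) := by
    refine tendstoInMeasure_of_tendsto_eLpNorm (p := ENNReal.ofReal q) (by simpa using hq)
      (fun n => (cont _).aestronglyMeasurable) (cont _).aestronglyMeasurable ?_
    have h0 : ENNReal.ofReal q ≠ 0 := by simpa using hq
    simp only [eLpNorm_eq_lintegral_rpow_enorm_toReal h0 ENNReal.ofReal_ne_top,
      ENNReal.toReal_ofReal hq.le]
    have := (ENNReal.continuous_rpow_const (y := 1 / q)).continuousAt.tendsto.comp hI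
    simpa [Function.comp_def, hq] using this
  obtain ⟨ns, -, hns⟩ := hm.exists_seq_tendsto_ae
  calc ∫⁻ θ in Ioc a b, ‖f.toFun (circleMap 0 r θ)‖ₑ ^ p
      = ∫⁻ θ in Ioc a b,
          liminf (fun i => ‖(u (ns i)).toFun (circleMap 0 r θ)‖ₑ ^ p) atTop := by
        refine lintegral_congr_ae ?_
        filter_upwards [hns] with θ hθ
        exact (((ENNReal.continuous_rpow_const (y := p)).tendsto _).comp hθ.enorm).liminf_eq.symm
    _ ≤ liminf (fun i => ∫⁻ θ in Ioc a b, ‖(u (ns i)).toFun (circleMap 0 r θ)‖ₑ ^ p) atTop :=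
        lintegral_liminf_le fun i => (cont _).measurable.enorm.pow_const p
    _ ≤ c := by
        refine (liminf_le_liminf (v := fun _ => c) (Eventually.of_forall fun i => hu (ns i))).trans ?_
        simp

theorem HardyInter.continuous_incl {p : ℝ} (q : ℝ) (h0 : 0 < q) (hp : q < p) :
    @Continuous _ _ _ (hardyMetric q h0).toUniformSpace.toTopologicalSpace
      (HardyInter.incl (p := p) q h0 hp) :=
  continuous_iff_le_induced.2 ((iInf_le _ q).trans ((iInf_le _ h0).trans (iInf_le _ hp)))

theorem isGδ_setOf_hardySup_eq_top {p : ℝ} (hp : 0 < p) :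
    IsGδ {f : HardyInter p |
      ∀ δ : ℝ, p ≤ δ → ∀ a b : ℝ, a < b → hardySup δ a b f.toFun = ⊤} := by
  rw [setOf_hardySup_eq_top_eq_iInter hp]
  refine .iInter fun ab => .iInter fun hab => ?_
  have : {f : HardyInter p | hardySup p ab.1 ab.2 f.toFun = ⊤} =
      ⋂ n : ℕ, {f : HardyInter p | (n : ℝ≥0∞) < hardySup p ab.1 ab.2 f.toFun} := by
    ext f
    simp only [mem_ofPred_eq, mem_iInter]
    refine ⟨fun h n => h ▸ ENNReal.natCast_lt_top n, fun h => ENNReal.eq_top_of_forall_nnreal_le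
      fun x => ?_⟩
    obtain ⟨n, hn⟩ := exists_nat_ge x
    exact (by exact_mod_cast hn : (x : ℝ≥0∞) ≤ n).trans (h n).le
  rw [this]
  refine .iInter fun n => IsOpen.isGδ ?_
  simp only [hardySup, lt_iSup_iff, ofPred_exists]
  refine isOpen_iUnion fun r => isOpen_iUnion fun hr => ?_
  -- Any exponent strictly between `0` and `p` would serve.
  let _ := hardyMetric (p / 2) (half_pos hp)
  have hc := (isClosed_setOf_setLIntegral_circleMap_le (half_pos hp) (p := p) hab.2 hr n).preimage
    (HardyInter.continuous_incl (p / 2) (half_pos hp) (half_lt_self hp))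
  convert hc.isOpen_compl using 1
  ext f
  simp [HardyInter.incl]

/-! ### Density by perturbation along one bad function -/

/-- The function `g + c F` as an element of the intersection. -/
noncomputable def HardyInter.addSMul {p : ℝ} (g F : HardyInter p) (c : ℂ) : HardyInter p where
  toFun := g.toFun + c • F.toFun
  holo := g.holo.add (F.holo.const_smul c)
  zero_off z hz := by simp [g.zero_off z hz, F.zero_off z hz]
  sup_lt_top q h0 hq := by
    refine hardySup_add_lt_top h0 g.holo (g.sup_lt_top q h0 hq) ?_
    rw [hardySup_const_smul h0.le]
    exact ENNReal.mul_lt_top (ENNReal.rpow_lt_top_of_nonneg h0.le enorm_ne_top)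
      (F.sup_lt_top q h0 hq)

theorem HardyInter.tendsto_addSMul {p : ℝ} (g F : HardyInter p) :
    Tendsto (fun c : ℝ => g.addSMul F c) (𝓝 0) (𝓝 g) := by
  simp only [nhds_iInf, tendsto_iInf, nhds_induced, tendsto_comap_iff]
  intro q h0 hq
  let _ := hardyMetric q h0
  refine tendsto_iff_edist_tendsto_0.2 ?_
  change Tendsto (fun c : ℝ => hardyDist q (g.toFun + (c : ℂ) • F.toFun) g.toFun) (𝓝 0) (𝓝 0)
  have he : (0 : ℝ) < min 1 (1 / q) := lt_min one_pos (by positivity)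
  simp only [hardyDist, add_sub_cancel_left, hardySup_const_smul h0.le]
  have h1 : Tendsto (fun c : ℝ => ‖(c : ℂ)‖ₑ ^ q) (𝓝 0) (𝓝 0) := by
    have := ((ENNReal.continuous_rpow_const (y := q)).comp
      (Complex.continuous_ofReal.enorm)).tendsto 0
    simpa [Function.comp_def, h0] using this
  have h2 := ENNReal.Tendsto.mul_const (b := hardySup q 0 (2 * Real.pi) F.toFun) h1
    (Or.inr (F.sup_lt_top q h0 hq).ne)
  rw [zero_mul] at h2
  have h3 := ((ENNReal.continuous_rpow_const (y := min 1 (1 / q))).tendsto 0).comp h2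
  simpa only [Function.comp_def, ENNReal.zero_rpow_of_pos he] using h3

/-- On each interval, at most one real translate `g + c F` of `g` is `L^p` bounded, as soon as `F`
is not. -/
theorem HardyInter.subsingleton_setOf_addSMul_lt_top {p : ℝ} (hp : 0 < p) (g F : HardyInter p)
    {a b : ℝ} (hF : hardySup p a b F.toFun = ⊤) :
    {c : ℝ | hardySup p a b (g.addSMul F c).toFun < ⊤}.Subsingleton := by
  intro c hc d hd
  by_contra hcd
  have hcd' : (c : ℂ) - d ≠ 0 := sub_ne_zero.2 (by exact_mod_cast hcd)
  -- Subtracting the two translates cancels `g` and leaves `(c - d) F`, whose supremum is infinite.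
  have h1 : hardySup p a b ((-1 : ℂ) • (g.addSMul F d).toFun) < ⊤ := by
    rw [hardySup_const_smul hp.le]
    simpa using hd
  have h2 := hardySup_add_lt_top hp (g.addSMul F c).holo hc h1
  have h3 : (g.addSMul F c).toFun + (-1 : ℂ) • (g.addSMul F d).toFun
      = ((c : ℂ) - d) • F.toFun := by
    ext z
    simp [HardyInter.addSMul]
    ring
  rw [h3, hardySup_const_smul hp.le, hF, ENNReal.mul_top] at h2
  · exact lt_irrefl _ h2
  · simp [ENNReal.rpow_eq_zero_iff, hp, hcd']

theorem dense_setOf_hardySup_eq_top {p : ℝ} (hp : 0 < p) (F : HardyInter p)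
    (hF : ∀ a b : ℝ, a < b → hardySup p a b F.toFun = ⊤) :
    Dense {f : HardyInter p |
      ∀ δ : ℝ, p ≤ δ → ∀ a b : ℝ, a < b → hardySup δ a b f.toFun = ⊤} := by
  intro g
  let B : Set ℝ := ⋃ (ab : ℚ × ℚ) (_ : (ab.1 : ℝ) < ab.2),
    {c : ℝ | hardySup p ab.1 ab.2 (g.addSMul F c).toFun < ⊤}
  have hB : B.Countable := countable_iUnion fun ab => countable_iUnion fun hab =>
    (g.subsingleton_setOf_addSMul_lt_top hp F (hF _ _ hab)).finite.countable
  have hz : (0 : ℝ) ∈ closure Bᶜ := hB.dense_compl ℝ 0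
  have _ : (𝓝[Bᶜ] (0 : ℝ)).NeBot := mem_closure_iff_nhdsWithin_neBot.1 hz
  refine mem_closure_of_tendsto (b := 𝓝[Bᶜ] (0 : ℝ)) ((g.tendsto_addSMul F).mono_left nhdsWithin_le_nhds)
    (eventually_mem_nhdsWithin.mono fun c hc => ?_)
  rw [setOf_hardySup_eq_top_eq_iInter hp]
  simp only [mem_iInter, mem_ofPred_eq]
  intro ab hab
  by_contra hne
  exact hc (mem_iUnion₂.2 ⟨ab, hab.1, lt_top_iff_ne_top.2 hne⟩)

/-! ### A single boundary singularity -/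

/-- Near `0`, `|sin θ| ≥ 2|θ|/π` reduces this to the integrability of `|θ|^{-s}`; the period `π` of
`|sin|` takes care of the other zeros. -/
theorem lintegral_enorm_sin_rpow_neg_lt_top {s : ℝ} (hs0 : 0 ≤ s) (hs : s < 1) :
    ∫⁻ θ in Ioc 0 (2 * Real.pi), ‖Real.sin θ‖ₑ ^ (-s) < ⊤ := by
  have hpi := Real.pi_pos
  have hne : ∀ θ ∈ Ioo (-(Real.pi / 2)) (Real.pi / 2), θ ≠ 0 → 0 < 2 / Real.pi * |θ| ∧
      2 / Real.pi * |θ| ≤ |Real.sin θ| := fun θ hθ h0 =>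
    ⟨mul_pos (by positivity) (abs_pos.2 h0), Real.mul_abs_le_abs_sin (abs_le.2 ⟨hθ.1.le, hθ.2.le⟩)⟩
  have hball : Metric.ball (0 : ℝ) (Real.pi / 2) = Ioo (-(Real.pi / 2)) (Real.pi / 2) := by
    rw [Real.ball_eq_Ioo, zero_sub, zero_add]
  have h0 : ∀ᵐ θ : ℝ ∂(volume.restrict (Ioo (-(Real.pi / 2)) (Real.pi / 2))), θ ≠ 0 :=
    Measure.ae_ne _ _
  have hint : IntegrableOn (fun θ => |Real.sin θ| ^ (-s)) (Ioo (-(Real.pi / 2)) (Real.pi / 2)) := by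
    rw [← hball]
    refine integrableOn_ball_of_norm_le_rpow (C := (2 / Real.pi) ^ (-s)) (α := s) (by simp)
      (by simpa using hs) ?_
      (by exact (Real.measurable_sin.abs.pow_const (-s)).aestronglyMeasurable)
    rw [hball]
    filter_upwards [h0, ae_restrict_mem measurableSet_Ioo] with θ hθ0 hθ
    obtain ⟨h1, h2⟩ := hne θ hθ hθ0
    rw [Real.norm_of_nonneg (by positivity), Real.norm_eq_abs,
      ← Real.mul_rpow (by positivity) (abs_nonneg _)]
    exact Real.rpow_le_rpow_of_nonpos h1 h2 (by linarith)
  have hfin : ∫⁻ θ in Ioc (-(Real.pi / 2)) (Real.pi / 2), ‖Real.sin θ‖ₑ ^ (-s) < ⊤ := by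
    rw [← setLIntegral_congr Ioo_ae_eq_Ioc]
    refine lt_of_eq_of_lt (lintegral_congr_ae ?_) hint.2
    filter_upwards [h0, ae_restrict_mem measurableSet_Ioo] with θ hθ0 hθ
    obtain ⟨h1, h2⟩ := hne θ hθ hθ0
    rw [Real.enorm_eq_ofReal_abs, ENNReal.ofReal_rpow_of_pos (h1.trans_le h2),
      Real.enorm_of_nonneg (by positivity)]
  have hper : Function.Periodic (fun θ => ‖Real.sin θ‖ₑ ^ (-s)) Real.pi := fun θ => by
    simp only [Real.sin_add_pi, enorm_neg]
  have hper' : ∀ x, ∫⁻ θ in Ioc x (x + Real.pi), ‖Real.sin θ‖ₑ ^ (-s) < ⊤ := fun x => by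
    rw [hper.setLIntegral_Ioc_eq hpi x (-(Real.pi / 2))]
    convert hfin using 4
    ring
  rw [← Ioc_union_Ioc_eq_Ioc hpi.le (by linarith)]
  refine (lintegral_union_le _ _ _).trans_lt (ENNReal.add_lt_top.2 ⟨?_, ?_⟩)
  · simpa using hper' 0
  · simpa [two_mul] using hper' Real.pi

/-- The difference of the squares is `(r - cos θ)²`. The bound is independent of `r`, hence gives a
majorant for all radii at once. -/
theorem abs_sin_le_norm_one_sub_circleMap (r θ : ℝ) :
    |Real.sin θ| ≤ ‖1 - circleMap 0 r θ‖ := by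
  rw [← Real.sqrt_sq_eq_abs, Complex.norm_def]
  refine Real.sqrt_le_sqrt ?_
  simp only [Complex.normSq_apply, circleMap, zero_add, Complex.sub_re, Complex.one_re,
    Complex.re_ofReal_mul, Complex.exp_ofReal_mul_I_re, Complex.sub_im, Complex.one_im,
    Complex.im_ofReal_mul, Complex.exp_ofReal_mul_I_im]
  nlinarith [sq_nonneg (r - Real.cos θ), Real.sin_sq_add_cos_sq θ]

/-- The branch of `(1 - e^{-it} z)^{-α}` on the disc, singular at the boundary point `e^{it}`. -/
noncomputable def diskSingularity (α t : ℝ) (z : ℂ) : ℂ :=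
  (1 - z * Complex.exp (-t * Complex.I)) ^ (-α : ℂ)

theorem norm_mul_exp_neg_ofReal_mul_I (z : ℂ) (t : ℝ) :
    ‖z * Complex.exp (-t * Complex.I)‖ = ‖z‖ := by
  rw [norm_mul, ← Complex.ofReal_neg, Complex.norm_exp_ofReal_mul_I, mul_one]

theorem circleMap_mul_exp_neg (r θ t : ℝ) :
    circleMap 0 r θ * Complex.exp (-t * Complex.I) = circleMap 0 r (θ - t) := by
  simp only [circleMap, zero_add, mul_assoc, ← Complex.exp_add]
  push_cast
  ring_nf

theorem one_sub_re_pos_of_norm_lt_one {w : ℂ} (hw : ‖w‖ < 1) : 0 < (1 - w).re := by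
  have := (Complex.re_le_norm w).trans_lt hw
  simpa using this

theorem diskSingularity_re_pos {z : ℂ} (hz : z ∈ Metric.ball (0 : ℂ) 1) (t : ℝ) :
    0 < (1 - z * Complex.exp (-t * Complex.I)).re :=
  one_sub_re_pos_of_norm_lt_one (by
    rw [norm_mul_exp_neg_ofReal_mul_I]; simpa using hz)

theorem norm_diskSingularity (α t : ℝ) (z : ℂ) :
    ‖diskSingularity α t z‖ = ‖1 - z * Complex.exp (-t * Complex.I)‖ ^ (-α) := by
  rw [diskSingularity, ← Complex.norm_cpow_real, Complex.ofReal_neg]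

theorem enorm_diskSingularity (α t : ℝ) {z : ℂ} (hz : z ∈ Metric.ball (0 : ℂ) 1) :
    ‖diskSingularity α t z‖ₑ = ‖1 - z * Complex.exp (-t * Complex.I)‖ₑ ^ (-α) := by
  have h : 0 < ‖1 - z * Complex.exp (-t * Complex.I)‖ :=
    norm_pos_iff.2 fun h => (diskSingularity_re_pos hz t).ne' (by rw [h]; simp)
  rw [← ofReal_norm, norm_diskSingularity, ← ENNReal.ofReal_rpow_of_pos h, ofReal_norm]

theorem norm_diskSingularity_le {α R : ℝ} (hα : 0 ≤ α) (hR : R < 1) (t : ℝ) {z : ℂ}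
    (hz : z ∈ Metric.ball (0 : ℂ) R) : ‖diskSingularity α t z‖ ≤ (1 - R) ^ (-α) := by
  rw [norm_diskSingularity]
  refine Real.rpow_le_rpow_of_nonpos (by linarith) ?_ (by linarith)
  have h := norm_sub_norm_le (1 : ℂ) (z * Complex.exp (-t * Complex.I))
  rw [norm_mul_exp_neg_ofReal_mul_I, norm_one] at h
  have := mem_ball_zero_iff.1 hz
  linarith

/-- The base lies in the right half-plane, so the argument of the power is at most `π/4` in modulus,
below `π/3`, where the cosine is `1/2`. -/
theorem norm_diskSingularity_le_two_mul_re {α : ℝ} (hα : 0 ≤ α) (hα' : α ≤ 1 / 2) (t : ℝ) {z : ℂ}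
    (hz : z ∈ Metric.ball (0 : ℂ) 1) :
    ‖diskSingularity α t z‖ ≤ 2 * (diskSingularity α t z).re := by
  have hre := diskSingularity_re_pos hz t
  have hne : 1 - z * Complex.exp (-t * Complex.I) ≠ 0 := fun h => hre.ne' (by rw [h]; simp)
  have harg := (Complex.abs_arg_lt_pi_div_two_iff.2 (Or.inl hre)).le
  have hn := norm_diskSingularity α t z
  rw [Real.rpow_def_of_pos (norm_pos_iff.2 hne)] at hn
  have : (diskSingularity α t z).re = ‖diskSingularity α t z‖ *
      Real.cos (α * (1 - z * Complex.exp (-t * Complex.I)).arg) := by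
    rw [hn, diskSingularity, Complex.cpow_def_of_ne_zero hne, Complex.exp_re]
    simp [Complex.log_re, Complex.log_im, mul_comm]
  rw [this]
  have hcos : 1 / 2 ≤ Real.cos (α * (1 - z * Complex.exp (-t * Complex.I)).arg) := by
    rw [← Real.cos_abs, ← Real.cos_pi_div_three]
    refine Real.cos_le_cos_of_nonneg_of_le_pi (abs_nonneg _) (by linarith [Real.pi_pos]) ?_
    rw [abs_mul, abs_of_nonneg hα]
    nlinarith [Real.pi_pos, abs_nonneg (1 - z * Complex.exp (-t * Complex.I)).arg]
  nlinarith [norm_nonneg (diskSingularity α t z)]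

theorem differentiableOn_diskSingularity (α t : ℝ) :
    DifferentiableOn ℂ (diskSingularity α t) (Metric.ball 0 1) := by
  refine DifferentiableOn.cpow (by fun_prop) (by fun_prop) fun z hz => ?_
  exact Complex.mem_slitPlane_iff.2 (Or.inl (diskSingularity_re_pos hz t))

/-! ### Superposition of singularities at a sequence of boundary points -/

/-- A superposition of singularities at the boundary points `e^{i t_j}`. -/
noncomputable def diskSingularitySum (α : ℝ) (t : ℕ → ℝ) (z : ℂ) : ℂ :=
  ∑' j, (1 / 2 : ℂ) ^ (j + 1) * diskSingularity α (t j) z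

theorem norm_half_pow_mul (j : ℕ) (w : ℂ) :
    ‖(1 / 2 : ℂ) ^ (j + 1) * w‖ = (1 / 2 : ℝ) ^ (j + 1) * ‖w‖ := by
  simp

theorem hasSum_half_pow_succ : HasSum (fun j : ℕ => (1 / 2 : ℝ) ^ (j + 1)) 1 := by
  simpa [pow_succ, div_eq_mul_inv, mul_comm] using hasSum_geometric_two' 1

theorem summable_diskSingularitySum {α : ℝ} (hα : 0 ≤ α) (t : ℕ → ℝ) {z : ℂ}
    (hz : z ∈ Metric.ball (0 : ℂ) 1) :
    Summable fun j => (1 / 2 : ℂ) ^ (j + 1) * diskSingularity α (t j) z := by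
  obtain ⟨R, hzR, hR⟩ := exists_between (mem_ball_zero_iff.1 hz)
  refine .of_norm_bounded (hasSum_half_pow_succ.summable.mul_right ((1 - R) ^ (-α))) fun j => ?_
  rw [norm_half_pow_mul]
  gcongr
  exact norm_diskSingularity_le hα hR _ (mem_ball_zero_iff.2 hzR)

theorem differentiableOn_diskSingularitySum {α : ℝ} (hα : 0 ≤ α) (t : ℕ → ℝ) :
    DifferentiableOn ℂ (diskSingularitySum α t) (Metric.ball 0 1) := by
  intro z hz
  obtain ⟨R, hzR, hR⟩ := exists_between (mem_ball_zero_iff.1 hz)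
  refine DifferentiableAt.differentiableWithinAt ?_
  refine (Complex.differentiableOn_tsum_of_summable_norm (U := Metric.ball (0 : ℂ) R)
    (hasSum_half_pow_succ.summable.mul_right ((1 - R) ^ (-α))) (fun j => ?_) Metric.isOpen_ball
    fun j w hw => ?_).differentiableAt (Metric.isOpen_ball.mem_nhds (mem_ball_zero_iff.2 hzR))
  · exact ((differentiableOn_diskSingularity α (t j)).mono
      (Metric.ball_subset_ball hR.le)).const_mul _
  · rw [norm_half_pow_mul]
    gcongr
    exact norm_diskSingularity_le hα hR _ hw

/-- All terms have nonnegative real part, so the real part of the sum is at least that of its `k`-th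
term. The constant is `2^{k+1}` from the weight times `2` from the sector bound. -/
theorem norm_diskSingularity_le_mul_norm_sum {α : ℝ} (hα : 0 ≤ α) (hα' : α ≤ 1 / 2) (t : ℕ → ℝ)
    (k : ℕ) {z : ℂ} (hz : z ∈ Metric.ball (0 : ℂ) 1) :
    ‖diskSingularity α (t k) z‖ ≤ 2 ^ (k + 2) * ‖diskSingularitySum α t z‖ := by
  have hre : ∀ j, ((1 / 2 : ℂ) ^ (j + 1) * diskSingularity α (t j) z).re =
      (1 / 2 : ℝ) ^ (j + 1) * (diskSingularity α (t j) z).re := fun j => by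
    rw [← Complex.re_ofReal_mul]; push_cast; rfl
  have hnn : ∀ j, 0 ≤ (diskSingularity α (t j) z).re := fun j => by
    linarith [norm_diskSingularity_le_two_mul_re hα hα' (t j) hz,
      norm_nonneg (diskSingularity α (t j) z)]
  have hs := Complex.hasSum_re (summable_diskSingularitySum hα t hz).hasSum
  simp only [hre] at hs
  have h1 : (1 / 2 : ℝ) ^ (k + 1) * (diskSingularity α (t k) z).re ≤
      (diskSingularitySum α t z).re :=
    le_hasSum hs k fun j _ => mul_nonneg (by positivity) (hnn j)
  have h2 := h1.trans (Complex.re_le_norm _)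
  have h3 := norm_diskSingularity_le_two_mul_re hα hα' (t k) hz
  rw [one_div, inv_pow, inv_mul_le_iff₀ (by positivity)] at h2
  calc _ ≤ _ := h3
    _ ≤ 2 * (2 ^ (k + 1) * ‖diskSingularitySum α t z‖) := by gcongr
    _ = _ := by ring

/-- Convexity of `x ↦ x^q` for weights of total mass `1`, as Hölder's inequality on finite partial
sums. -/
theorem enorm_diskSingularitySum_rpow_le {α : ℝ} (hα : 0 ≤ α) (t : ℕ → ℝ) {q : ℝ} (hq : 1 ≤ q)
    {z : ℂ} (hz : z ∈ Metric.ball (0 : ℂ) 1) :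
    ‖diskSingularitySum α t z‖ₑ ^ q ≤
      ∑' j, ENNReal.ofReal ((1 / 2) ^ (j + 1)) * ‖diskSingularity α (t j) z‖ₑ ^ q := by
  have hq0 : 0 < q := by linarith
  rw [← ENNReal.le_rpow_inv_iff hq0]
  refine le_of_tendsto (summable_diskSingularitySum hα t hz).hasSum.enorm
    (Eventually.of_forall fun s => ?_)
  calc ‖∑ j ∈ s, (1 / 2 : ℂ) ^ (j + 1) * diskSingularity α (t j) z‖ₑ
      ≤ ∑ j ∈ s, ‖(1 / 2 : ℂ) ^ (j + 1) * diskSingularity α (t j) z‖ₑ := enorm_sum_le _ _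
    _ = ∑ j ∈ s, ENNReal.ofReal ((1 / 2) ^ (j + 1)) * ‖diskSingularity α (t j) z‖ₑ :=
        Finset.sum_congr rfl fun j _ => by
          rw [← ofReal_norm, norm_half_pow_mul, ENNReal.ofReal_mul (by positivity), ofReal_norm]
    _ ≤ (∑ j ∈ s, ENNReal.ofReal ((1 / 2) ^ (j + 1))) ^ (1 - q⁻¹) *
          (∑ j ∈ s, ENNReal.ofReal ((1 / 2) ^ (j + 1)) *
            ‖diskSingularity α (t j) z‖ₑ ^ q) ^ q⁻¹ :=
        ENNReal.inner_le_weight_mul_Lp_of_nonneg s hq _ _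
    _ ≤ 1 * (∑' j, ENNReal.ofReal ((1 / 2) ^ (j + 1)) *
            ‖diskSingularity α (t j) z‖ₑ ^ q) ^ q⁻¹ := by
        gcongr
        · refine ENNReal.rpow_le_one ?_ (sub_nonneg.2 (inv_le_one_of_one_le₀ hq))
          rw [← ENNReal.ofReal_sum_of_nonneg fun _ _ => by positivity, ENNReal.ofReal_le_one]
          exact sum_le_hasSum s (fun _ _ => by positivity) hasSum_half_pow_succ
        · exact ENNReal.sum_le_tsum s
    _ = _ := one_mul _

theorem hardySup_diskSingularitySum_lt_top {α : ℝ} (hα : 0 ≤ α) (t : ℕ → ℝ) {q : ℝ} (hq : 1 ≤ q)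
    (hαq : α * q < 1) : hardySup q 0 (2 * Real.pi) (diskSingularitySum α t) < ⊤ := by
  have hq0 : 0 ≤ q := by linarith
  refine lt_of_le_of_lt ?_ (lintegral_enorm_sin_rpow_neg_lt_top (mul_nonneg hα hq0) hαq)
  refine iSup₂_le fun r hr => ?_
  have hz : ∀ θ, circleMap 0 r θ ∈ Metric.ball (0 : ℂ) 1 := fun θ => by
    simp [abs_of_pos hr.1, hr.2]
  have hper : Function.Periodic (fun θ => ‖Real.sin θ‖ₑ ^ (-(α * q))) (2 * Real.pi) := fun θ => by
    simp only [Real.sin_add_two_pi]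
  have hterm : ∀ s : ℝ, ∫⁻ θ in Ioc 0 (2 * Real.pi), ‖diskSingularity α s (circleMap 0 r θ)‖ₑ ^ q ≤
      ∫⁻ θ in Ioc 0 (2 * Real.pi), ‖Real.sin θ‖ₑ ^ (-(α * q)) := by
    intro s
    calc ∫⁻ θ in Ioc 0 (2 * Real.pi), ‖diskSingularity α s (circleMap 0 r θ)‖ₑ ^ q
        ≤ ∫⁻ θ in Ioc 0 (2 * Real.pi), ‖Real.sin (θ - s)‖ₑ ^ (-(α * q)) := by
          refine lintegral_mono fun θ => ?_
          rw [enorm_diskSingularity α s (hz θ), circleMap_mul_exp_neg, ← ENNReal.rpow_mul, neg_mul]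
          rw [ENNReal.rpow_neg, ENNReal.rpow_neg, ENNReal.inv_le_inv]
          refine ENNReal.rpow_le_rpow ?_ (mul_nonneg hα hq0)
          rw [enorm_le_iff_norm_le]
          exact abs_sin_le_norm_one_sub_circleMap r (θ - s)
      _ = ∫⁻ θ in Ioc s (s + 2 * Real.pi), ‖Real.sin (θ - s)‖ₑ ^ (-(α * q)) := by
          have := (hper.sub_const s).setLIntegral_Ioc_eq Real.two_pi_pos 0 s
          rwa [zero_add] at this
      _ = ∫⁻ θ in Ioc 0 (2 * Real.pi), ‖Real.sin θ‖ₑ ^ (-(α * q)) := by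
          rw [← (measurePreserving_sub_right volume s).setLIntegral_comp_preimage_emb
            (measurableEmbedding_subRight s) _ (Ioc 0 (2 * Real.pi))]
          simp [add_comm]
  have hmeas : ∀ s : ℝ, Measurable fun θ => ‖diskSingularity α s (circleMap 0 r θ)‖ₑ ^ q := fun s =>
    (measurable_circle_of_holo (differentiableOn_diskSingularity α s) hr).pow_const q
  calc ∫⁻ θ in Ioc 0 (2 * Real.pi), ‖diskSingularitySum α t (circleMap 0 r θ)‖ₑ ^ q
      ≤ ∫⁻ θ in Ioc 0 (2 * Real.pi), ∑' j, ENNReal.ofReal ((1 / 2) ^ (j + 1)) *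
          ‖diskSingularity α (t j) (circleMap 0 r θ)‖ₑ ^ q :=
        lintegral_mono fun θ => enorm_diskSingularitySum_rpow_le hα t hq (hz θ)
    _ = ∑' j, ENNReal.ofReal ((1 / 2) ^ (j + 1)) *
          ∫⁻ θ in Ioc 0 (2 * Real.pi), ‖diskSingularity α (t j) (circleMap 0 r θ)‖ₑ ^ q := by
        rw [lintegral_tsum fun j => ((hmeas (t j)).const_mul _).aemeasurable]
        simp only [lintegral_const_mul _ (hmeas _)]
    _ ≤ ∑' j, ENNReal.ofReal ((1 / 2) ^ (j + 1)) *
          ∫⁻ θ in Ioc 0 (2 * Real.pi), ‖Real.sin θ‖ₑ ^ (-(α * q)) :=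
        ENNReal.tsum_le_tsum fun j => mul_le_mul_right (hterm _) _
    _ = _ := by
        rw [ENNReal.tsum_mul_right, ← ENNReal.ofReal_tsum_of_nonneg (fun _ => by positivity)
          hasSum_half_pow_succ.summable, hasSum_half_pow_succ.tsum_eq, ENNReal.ofReal_one, one_mul]

theorem hardySup_diskSingularitySum_eq_top {p : ℝ} (hp : 2 ≤ p) {t : ℕ → ℝ} (ht : DenseRange t)
    {a b : ℝ} (hab : a < b) : hardySup p a b (diskSingularitySum (1 / p) t) = ⊤ := by
  have hp0 : 0 < p := by linarith
  have hα' : 1 / p ≤ 1 / 2 := one_div_le_one_div_of_le two_pos hp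
  obtain ⟨k, hk⟩ := ht.exists_mem_open isOpen_Ioo (nonempty_Ioo.2 hab)
  by_contra hne
  set S := hardySup p a b (diskSingularitySum (1 / p) t)
  have hC : ((2 : ℝ≥0∞) ^ (k + 2)) ^ p ≠ ⊤ := ENNReal.rpow_ne_top_of_nonneg hp0.le (by simp)
  have hpt : ∀ r ∈ Ioo (0 : ℝ) 1, ∀ θ, ‖1 - circleMap 0 r (θ - t k)‖ₑ⁻¹ ≤
      ((2 : ℝ≥0∞) ^ (k + 2)) ^ p * ‖diskSingularitySum (1 / p) t (circleMap 0 r θ)‖ₑ ^ p := by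
    intro r hr θ
    have hz : circleMap 0 r θ ∈ Metric.ball (0 : ℂ) 1 := by simp [abs_of_pos hr.1, hr.2]
    have h1 := norm_diskSingularity_le_mul_norm_sum (by positivity) hα' t k hz
    have h2 : ‖diskSingularity (1 / p) (t k) (circleMap 0 r θ)‖ₑ ≤
        2 ^ (k + 2) * ‖diskSingularitySum (1 / p) t (circleMap 0 r θ)‖ₑ := by
      rw [← ofReal_norm, ← ofReal_norm (diskSingularitySum _ _ _)]
      refine (ENNReal.ofReal_le_ofReal h1).trans_eq ?_
      rw [ENNReal.ofReal_mul (by positivity), ENNReal.ofReal_pow (by norm_num), ENNReal.ofReal_ofNat]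
    have h3 := ENNReal.rpow_le_rpow h2 hp0.le
    rw [enorm_diskSingularity _ _ hz, circleMap_mul_exp_neg, ← ENNReal.rpow_mul,
      ENNReal.mul_rpow_of_nonneg _ _ hp0.le] at h3
    rwa [neg_mul, one_div_mul_cancel hp0.ne', ENNReal.rpow_neg_one] at h3
  -- The part of the interval to the right of `t k` is enough for divergence.
  have hint : ∀ r ∈ Ioo (0 : ℝ) 1, ∫⁻ θ in Ioc (t k) b, ‖1 - circleMap 0 r (θ - t k)‖ₑ⁻¹ ≤
      ((2 : ℝ≥0∞) ^ (k + 2)) ^ p * S := by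
    intro r hr
    refine (lintegral_mono fun θ => hpt r hr θ).trans ?_
    rw [lintegral_const_mul' _ _ hC]
    gcongr
    exact (lintegral_mono_set (Ioc_subset_Ioc_left hk.1.le)).trans
      (setLIntegral_circleMap_le_hardySup hr _)
  have hlim : Tendsto (fun n : ℕ => 1 - 1 / ((n : ℝ) + 2)) atTop (𝓝 1) := by
    have := ((tendsto_one_div_add_atTop_nhds_zero_nat (𝕜 := ℝ)).comp (tendsto_add_atTop_nat 1)).const_sub 1
    refine Tendsto.congr (fun n => ?_) (by simpa using this)
    simp; ring
  have hr : ∀ n : ℕ, 1 - 1 / ((n : ℝ) + 2) ∈ Ioo (0 : ℝ) 1 := fun n => by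
    have h1 : 1 / ((n : ℝ) + 2) < 1 := by
      rw [div_lt_one (by positivity)]; linarith [Nat.cast_nonneg (α := ℝ) n]
    have h2 : 0 < 1 / ((n : ℝ) + 2) := by positivity
    constructor <;> linarith
  -- Let the radii tend to `1` and apply Fatou: since `|1 - e^{ix}| ≤ |x|`, a finite supremum would
  -- make `1/(θ - t k)` integrable up to its pole.
  have hfin : ∫⁻ θ in Ioc (t k) b, ‖(θ - t k)⁻¹‖ₑ < ⊤ := by
    refine lt_of_le_of_lt ?_ (ENNReal.mul_lt_top hC.lt_top (lt_top_iff_ne_top.2 hne))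
    calc ∫⁻ θ in Ioc (t k) b, ‖(θ - t k)⁻¹‖ₑ
        ≤ ∫⁻ θ in Ioc (t k) b, liminf (fun n : ℕ =>
            ‖1 - circleMap 0 (1 - 1 / ((n : ℝ) + 2)) (θ - t k)‖ₑ⁻¹) atTop := by
          refine setLIntegral_mono' measurableSet_Ioc fun θ hθ => ?_
          have hc : Continuous fun r : ℝ => ‖1 - circleMap 0 r (θ - t k)‖ₑ⁻¹ := by
            unfold circleMap
            exact continuous_inv.comp (by fun_prop)
          have hl := ((hc.tendsto 1).comp hlim).liminf_eq
          simp only [Function.comp_def] at hl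
          rw [hl, enorm_inv (sub_pos.2 hθ.1).ne',
            ENNReal.inv_le_inv, enorm_le_iff_norm_le, norm_sub_rev]
          have := Real.norm_exp_I_mul_ofReal_sub_one_le (x := θ - t k)
          simpa [circleMap, mul_comm] using this
      _ ≤ liminf (fun n : ℕ => ∫⁻ θ in Ioc (t k) b,
            ‖1 - circleMap 0 (1 - 1 / ((n : ℝ) + 2)) (θ - t k)‖ₑ⁻¹) atTop :=
          lintegral_liminf_le fun n => by
            unfold circleMap
            exact Measurable.inv (by fun_prop)
      _ ≤ ((2 : ℝ≥0∞) ^ (k + 2)) ^ p * S := by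
          refine (liminf_le_liminf (v := fun _ => ((2 : ℝ≥0∞) ^ (k + 2)) ^ p * S)
            (Eventually.of_forall fun n => hint _ (hr n))).trans ?_
          simp
  have hii : IntervalIntegrable (fun θ => (θ - t k)⁻¹) volume (t k) b := by
    rw [intervalIntegrable_iff_integrableOn_Ioc_of_le hk.2.le]
    exact ⟨by fun_prop, hfin⟩
  rw [intervalIntegrable_sub_inv_iff] at hii
  rcases hii with h | h
  · exact hk.2.ne h
  · exact h left_mem_uIcc

/-! ### The bad function for every `p`, and the theorem -/

theorem hardySup_congr {q a b : ℝ} {f g : ℂ → ℂ} (h : EqOn f g (Metric.ball 0 1)) :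
    hardySup q a b f = hardySup q a b g := by
  refine iSup_congr fun r => iSup_congr fun hr => lintegral_congr fun θ => ?_
  rw [h (by simp [abs_of_pos hr.1, hr.2])]

theorem hardySup_pow (q a b : ℝ) (m : ℕ) (f : ℂ → ℂ) :
    hardySup q a b (f ^ m) = hardySup (m * q) a b f := by
  simp only [hardySup, Pi.pow_apply, enorm_pow, ← ENNReal.rpow_natCast, ← ENNReal.rpow_mul]

theorem exists_hardyInter_forall_hardySup_eq_top {p : ℝ} (hp : 0 < p) :
    ∃ F : HardyInter p, ∀ a b : ℝ, a < b → hardySup p a b F.toFun = ⊤ := by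
  -- This gives `mp ≥ 2`, the range in which the sector bound holds.
  obtain ⟨m, hm⟩ := exists_nat_ge (2 / p)
  rw [div_le_iff₀ hp] at hm
  have hm0 : 0 < (m : ℝ) := by
    by_contra h
    nlinarith
  let G : ℂ → ℂ := diskSingularitySum (1 / (m * p)) (TopologicalSpace.denseSeq ℝ)
  have hG : DifferentiableOn ℂ G (Metric.ball 0 1) :=
    differentiableOn_diskSingularitySum (by positivity) _
  have heq : EqOn ((Metric.ball (0 : ℂ) 1).indicator (G ^ m)) (G ^ m) (Metric.ball 0 1) :=
    eqOn_indicator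
  refine ⟨⟨(Metric.ball (0 : ℂ) 1).indicator (G ^ m), (hG.pow m).congr heq,
    fun z hz => indicator_of_notMem hz _, fun q h0 hq => ?_⟩, fun a b hab => ?_⟩
  · rw [hardySup_congr heq, hardySup_pow]
    -- The convexity bound needs an exponent at least `1`; `max (m * q) 1` is one, still below `mp`
    -- because `mp ≥ 2`.
    refine hardySup_lt_top_of_exponent_le (by positivity) (le_max_left (m * q) 1)
      (hardySup_diskSingularitySum_lt_top (by positivity) _ (le_max_right _ _) ?_)
    rw [one_div_mul_eq_div, div_lt_one (by positivity)]
    exact max_lt (by gcongr) (by linarith)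
  · simp only []
    rw [hardySup_congr heq, hardySup_pow]
    exact hardySup_diskSingularitySum_eq_top hm (TopologicalSpace.denseRange_denseSeq ℝ) hab

theorem theoremA (p : ℝ) (hp : 0 < p) :
    (∃ f : ℂ → ℂ, DifferentiableOn ℂ f (Metric.ball 0 1) ∧
      (∀ q : ℝ, 0 < q → q < p → hardySup q 0 (2 * Real.pi) f < ⊤) ∧
      (∀ δ : ℝ, p ≤ δ → ∀ a b : ℝ, a < b → hardySup δ a b f = ⊤)) ∧
    IsGδ {f : HardyInter p |
      ∀ δ : ℝ, p ≤ δ → ∀ a b : ℝ, a < b → hardySup δ a b f.toFun = ⊤} ∧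
    Dense {f : HardyInter p |
      ∀ δ : ℝ, p ≤ δ → ∀ a b : ℝ, a < b → hardySup δ a b f.toFun = ⊤} := by
  obtain ⟨F, hF⟩ := exists_hardyInter_forall_hardySup_eq_top hp
  have hdense := dense_setOf_hardySup_eq_top hp F hF
  obtain ⟨f, hf⟩ := hdense.nonempty_iff.2 ⟨F⟩
  exact ⟨⟨f.toFun, f.holo, f.sup_lt_top, hf⟩, isGδ_setOf_hardySup_eq_top hp, hdense⟩
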